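/- Consider a POMDP with state space $S$, action space $A$, initial distribution $\rho_0$, transition kernel $\mathcal T$ and reward $r(s,a)$. In state $s_t$ it emits an observation $o_t$ for the student and a privileged observation $\omega_t$ for the teacher. A student policy $\pi$ chooses $a_t\sim\pi(\cdot|\tau_t)$ from the history $\tau_t=(o_0,a_0,\dots,a_{t-1},o_t)$; the teacher policy is $\bar\pi(\cdot|\omega)$. Let $H\in\mathbb N\cup\{\infty\}$ be the horizon and $\gamma\in[0,1]$ the discount factor, with $\gamma<1$ if $H=\infty$, let $\alpha\in\mathbb R$, and let $H^X_t(\pi|\bar\pi)=\mathbb E_{a\sim\pi(\cdot|\tau_t)}[\ell(\omega_t,a)]$ be the cross-entropy term, where $\ell(\omega,a)$ is $-\log\bar\pi(a|\omega)$, possibly clipped to an interval. Put $$J_R(\pi)=\mathbb E_\pi\Big[\sum_{t=0}^{H}\gamma^t r(s_t,a_t)\Big],\qquad J_{TG}(\pi,\alpha)=\mathbb E_\pi\Big[\sum_{t=0}^{H}\gamma^t\big(r(s_t,a_t)-\alpha H^X_t(\pi|\bar\pi)\big)\Big].$$ Assume that $r$ is bounded and that the cross-entropy term is bounded (over all policies;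 equivalently, that $\ell$ is bounded). Let $(\eta_i)$ be a sequence of real numbers for which there is an $\varepsilon>0$ with $\eta_i\le\sup_\pi J_R(\pi)-\varepsilon$ for all $i$. Then for every $i$ the constrained problem with $\eta=\eta_i$ has no duality gap: $$\sup_{\pi:\,J_R(\pi)\ge\eta}J_{TG}(\pi,\alpha)\;=\;\min_{\lambda\ge0}\,\sup_{\pi}\Big[(1+\lambda)\,J_{TG}\big(\pi,\tfrac{\alpha}{1+\lambda}\big)-\lambda\eta\Big],$$ where the minimum over $\lambda$ is attained. If moreover $\eta_i$ converges to a limit $\eta$ (in particular, if it increases monotonically to $\eta$), then the same equality holds for this limit $\eta$. -/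

import Mathlib

open MeasureTheory ProbabilityTheory Filter Topology
open scoped ENNReal

namespace TGRL

noncomputable section

/-- A discrete-time POMDP with states `S`, student observations `Ω`, privileged (teacher)
observations `Ωp` and actions `A`. The kernel `obs` emits the student observation and the privileged
observation jointly, given the current state: its first marginal is the observation function of the
POMDP, and the case in which the student observation is a function of the privileged one is
included. -/
structure POMDP (S Ω Ωp A : Type*) [MeasurableSpace S] [MeasurableSpace Ω] [MeasurableSpace Ωp]
    [MeasurableSpace A] where
  /-- the initial state distribution -/
  init : Measure S
  init_prob : IsProbabilityMeasure init
  /-- the state transition function -/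
  trans : Kernel (S × A) S
  trans_markov : IsMarkovKernel trans
  /-- the joint law of the two observations in a given state -/
  obs : Kernel S (Ω × Ωp)
  obs_markov : IsMarkovKernel obs
  /-- the reward function -/
  reward : S → A → ℝ
  reward_meas : Measurable (fun p : S × A => reward p.1 p.2)

attribute [instance] POMDP.init_prob POMDP.trans_markov POMDP.obs_markov

/-- Student histories `τ_t = (o_0, a_0, …, o_{t-1}, a_{t-1}, o_t)`. -/
abbrev Hist (Ω A : Type*) (t : ℕ) : Type _ := (Fin t → Ω × A) × Ω

/-- A (randomized, history-dependent) student policy: for every time a Markov kernel from the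
histories to the actions. -/
structure Policy (Ω A : Type*) [MeasurableSpace Ω] [MeasurableSpace A] where
  act : ∀ t : ℕ, Kernel (Hist Ω A t) A
  act_markov : ∀ t, IsMarkovKernel (act t)

attribute [instance] Policy.act_markov

/-- A teacher policy `π̄ : Ωp → Δ(A)`, given by its densities `dens ω a = π̄(a|ω)` with respect to a
reference measure `μ` on the actions (the counting measure in the discrete case). -/
structure Teacher (Ωp : Type*) {A : Type*} [MeasurableSpace Ωp] [MeasurableSpace A]
    (μ : Measure A) where
  dens : Ωp → A → ℝ≥0∞
  dens_meas : Measurable (fun p : Ωp × A => dens p.1 p.2)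
  dens_lintegral : ∀ ω, ∫⁻ a, dens ω a ∂μ = 1

/-- What happens in one time step: `((s_t, (o_t, ω_t)), a_t)`. -/
abbrev Step (S Ω Ωp A : Type*) : Type _ := (S × (Ω × Ωp)) × A

section

variable {S Ω Ωp A : Type*}

/-- The state in a step. -/
def Step.state (x : Step S Ω Ωp A) : S := x.1.1

/-- The student observation in a step. -/
def Step.ob (x : Step S Ω Ωp A) : Ω := x.1.2.1

/-- The privileged observation in a step. -/
def Step.priv (x : Step S Ω Ωp A) : Ωp := x.1.2.2

/-- The action in a step. -/
def Step.action (x : Step S Ω Ωp A) : A := x.2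

variable [MeasurableSpace S] [MeasurableSpace Ω] [MeasurableSpace Ωp] [MeasurableSpace A]

/-- The history that the student sees at time `0`. -/
def firstHist (p : S × (Ω × Ωp)) : Hist Ω A 0 := (Fin.elim0, p.2.1)

/-- The history that the student sees at time `n + 1`, in terms of the steps `0, …, n` and of the
new state and observations. -/
def nextHist (n : ℕ) (p : (((_ : Finset.Iic n) → Step S Ω Ωp A) × (S × (Ω × Ωp)))) :
    Hist Ω A (n + 1) :=
  (fun i : Fin (n + 1) =>
      (Step.ob (p.1 ⟨i, Finset.mem_Iic.2 (Nat.lt_succ_iff.1 i.2)⟩),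
        Step.action (p.1 ⟨i, Finset.mem_Iic.2 (Nat.lt_succ_iff.1 i.2)⟩)),
    p.2.2.1)

/-- The state and the action in the last of the steps `0, …, n`. -/
def lastStateAction (n : ℕ) (x : (_ : Finset.Iic n) → Step S Ω Ωp A) : S × A :=
  (Step.state (x ⟨n, Finset.mem_Iic.2 le_rfl⟩), Step.action (x ⟨n, Finset.mem_Iic.2 le_rfl⟩))

lemma measurable_firstHist :
    Measurable (firstHist : S × (Ω × Ωp) → Hist Ω A 0) := by
  unfold firstHist
  fun_prop

lemma measurable_nextHist (n : ℕ) :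
    Measurable (nextHist n :
      (((_ : Finset.Iic n) → Step S Ω Ωp A) × (S × (Ω × Ωp))) → Hist Ω A (n + 1)) := by
  unfold nextHist Step.ob Step.action
  fun_prop

lemma measurable_lastStateAction (n : ℕ) :
    Measurable (lastStateAction n : ((_ : Finset.Iic n) → Step S Ω Ωp A) → S × A) := by
  unfold lastStateAction Step.state Step.action
  fun_prop

namespace POMDP

variable (M : POMDP S Ω Ωp A) (π : Policy Ω A)

/-- The law of the first step: `s_0 ∼ ρ_0`, `(o_0, ω_0) ∼ O(·|s_0)`, `a_0 ∼ π(·|τ_0)`. -/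
def firstStep : Measure (Step S Ω Ωp A) :=
  (M.init ⊗ₘ M.obs) ⊗ₘ ((π.act 0).comap firstHist measurable_firstHist)

instance : IsProbabilityMeasure (M.firstStep π) := by
  unfold firstStep
  infer_instance

/-- The law of step `n + 1` given the steps `0, …, n`: `s_{n+1} ∼ T(·|s_n, a_n)`,
`(o_{n+1}, ω_{n+1}) ∼ O(·|s_{n+1})`, `a_{n+1} ∼ π(·|τ_{n+1})`. -/
def nextStep (n : ℕ) : Kernel ((_ : Finset.Iic n) → Step S Ω Ωp A) (Step S Ω Ωp A) :=
  ((M.trans.comap (lastStateAction n) (measurable_lastStateAction n)) ⊗ₖ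
      (M.obs.comap Prod.snd measurable_snd)) ⊗ₖ
    ((π.act (n + 1)).comap (nextHist n) (measurable_nextHist n))

instance (n : ℕ) : IsMarkovKernel (M.nextStep π n) := by
  unfold nextStep
  infer_instance

/-- The law of the infinite trajectory when the student follows `π`. -/
def law : Measure (ℕ → Step S Ω Ωp A) :=
  Kernel.trajMeasure (X := fun _ => Step S Ω Ωp A) (M.firstStep π) (M.nextStep π)

end POMDP

/-- The history `τ_t` along a trajectory. -/
def hist (t : ℕ) (x : ℕ → Step S Ω Ωp A) : Hist Ω A t :=
  (fun i : Fin t => (Step.ob (x i), Step.action (x i)), Step.ob (x t))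

/-- The discount weight of time `t` for the discount factor `γ` and the horizon `H`, where `H = ⊤`
is the infinite horizon: `γ ^ t` for `t ≤ H`, and `0` afterwards. -/
def weight (γ : ℝ) (H : ℕ∞) (t : ℕ) : ℝ := if (t : ℕ∞) ≤ H then γ ^ t else 0

variable {μ : Measure A}

/-- The loss `- log π̄(a|ω)` (with `- log 0 = ⊤`), clipped to the interval `[lo, hi]`.
With `lo = ⊥` and `hi = ⊤` there is no clipping. -/
def Teacher.logLoss (T : Teacher Ωp μ) (lo hi : EReal) (ω : Ωp) (a : A) : EReal :=
  max lo (min (-(ENNReal.log (T.dens ω a))) hi)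

/-- The (clipped) cross-entropy `H^X_t(π|π̄) = 𝔼_{a ∼ π(·|τ_t)} [- log π̄(a|ω_t)]` at the history
`τ` and the privileged observation `ω`. -/
def Teacher.crossEntropy (T : Teacher Ωp μ) (lo hi : EReal) (π : Policy Ω A) (t : ℕ)
    (τ : Hist Ω A t) (ω : Ωp) : ℝ :=
  ∫ a, (T.logLoss lo hi ω a).toReal ∂(π.act t τ)

namespace POMDP

variable (M : POMDP S Ω Ωp A) (γ : ℝ) (H : ℕ∞)

/-- The expected return `J_R(π) = 𝔼_π [∑_t γ^t r_t]`. -/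
def JR (π : Policy Ω A) : ℝ :=
  ∫ x, ∑' t, weight γ H t * M.reward (x t).state (x t).action ∂(M.law π)

/-- The teacher-guided objective `J_TG(π, α) = 𝔼_π [∑_t γ^t (r_t - α H^X_t(π|π̄))]`. -/
def JTG (T : Teacher Ωp μ) (lo hi : EReal) (π : Policy Ω A) (α : ℝ) : ℝ :=
  ∫ x, ∑' t, weight γ H t * (M.reward (x t).state (x t).action
      - α * T.crossEntropy lo hi π t (hist t x) (x t).priv) ∂(M.law π)

/-- The optimal return `sup_π J_R(π)`. -/
def optimalReturn : EReal := ⨆ π : Policy Ω A, (M.JR γ H π : EReal)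

/-- The value of the primal problem `max_π J_TG(π, α)` subject to `J_R(π) ≥ η`
(`⊥` if no policy is feasible). -/
def primalValue (T : Teacher Ωp μ) (lo hi : EReal) (α η : ℝ) : EReal :=
  ⨆ (π : Policy Ω A) (_ : η ≤ M.JR γ H π), (M.JTG γ H T lo hi π α : EReal)

/-- The dual function `λ ↦ max_π [(1 + λ) J_TG(π, α / (1 + λ)) - λ η]`. -/
def dualFunction (T : Teacher Ωp μ) (lo hi : EReal) (α η l : ℝ) : EReal :=
  ⨆ π : Policy Ω A, (((1 + l) * M.JTG γ H T lo hi π (α / (1 + l)) - l * η : ℝ) : EReal)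

/-- There is no duality gap: the dual problem `min_{λ ≥ 0}` of the dual function has a minimum, and
its value is that of the primal problem. -/
def NoDualityGap (T : Teacher Ωp μ) (lo hi : EReal) (α η : ℝ) : Prop :=
  IsLeast (M.dualFunction γ H T lo hi α η '' Set.Ici 0) (M.primalValue γ H T lo hi α η)

end POMDP

end

end

end TGRL

/-! The pair of numbers (`J_R`, `J_TG`) has convex range over policies, so strong duality reduces to
a Lagrange multiplier argument in the plane. Convexity: draw `π₁` with probability `a` and `π₂` with
probability `b`, then follow the chosen one. This is not literally a policy, since the choice is
hidden. Replace it by the policy that at history `τ` plays `π₁` or `π₂` with the posterior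
probabilities of the two choices. A priori the posterior depends on the whole past, including states
and privileged observations; but the environment acts identically under both policies and actions
are drawn from the history alone, so the posterior is a function of `τ` (`sufficient_preHist`). By
Bayes' rule the law at each time is then the mixture of the two laws (`map_eval_mixPolicy`). Both
objectives are discounted sums of expectations of one step, because the cross-entropy is the
conditional expectation of the loss at the drawn action (`JTG_eq`); hence they are affine under
mixing (`stepSum_mixPolicy`). Duality: since `(1 + λ) J_TG(π, α / (1 + λ)) = J_TG(π, α) + λ J_R(π)`,
the dual function is the usual Lagrangian supremum. A strictly feasible policy exists because of the
margin `ε`, and `exists_multiplier` yields an optimal `λ` without any compactness of the policy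
space. The margin is uniform in `i`, so it survives in the limit. -/

namespace TGRL

/-! ### Sufficient statistics for a pair of measures. -/

section Sufficient

variable {X Y T U A : Type*} [MeasurableSpace X] [MeasurableSpace Y] [MeasurableSpace T]
  [MeasurableSpace U] [MeasurableSpace A]

/-- The pair of densities of `μ` and `ν` with respect to `μ + ν` factors through `f`. -/
structure IsPosterior (f : X → T) (μ ν : Measure X) (p q : T → ℝ≥0∞) : Prop where
  measurable_left : Measurable p
  measurable_right : Measurable q
  add_eq_one : ∀ t, p t + q t = 1
  left_eq : μ = (μ + ν).withDensity (p ∘ f)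
  right_eq : ν = (μ + ν).withDensity (q ∘ f)

/-- The statistic `f` is sufficient for the pair of measures `μ`, `ν`. -/
def Sufficient (f : X → T) (μ ν : Measure X) : Prop :=
  ∃ p q, IsPosterior f μ ν p q

lemma withDensity_comp_map {μ : Measure X} {e : X → Y} (he : Measurable e) {g : Y → ℝ≥0∞}
    (hg : Measurable g) : (μ.withDensity (g ∘ e)).map e = (μ.map e).withDensity g := by
  ext s hs
  rw [Measure.map_apply he hs, withDensity_apply _ (he hs), withDensity_apply _ hs,
    setLIntegral_map hs hg he]
  rfl

lemma withDensity_comp_fst_compProd {μ : Measure X} [IsFiniteMeasure μ] {κ : Kernel X Y}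
    [IsMarkovKernel κ] {g : X → ℝ≥0∞} (hg : Measurable g) [SFinite (μ.withDensity g)] :
    (μ ⊗ₘ κ).withDensity (g ∘ Prod.fst) = (μ.withDensity g) ⊗ₘ κ := by
  ext s hs
  rw [withDensity_apply _ hs, ← lintegral_indicator hs, Measure.lintegral_compProd
    ((hg.comp measurable_fst).indicator hs), Measure.compProd_apply hs,
    lintegral_withDensity_eq_lintegral_mul _ hg (Kernel.measurable_kernel_prodMk_left hs)]
  refine lintegral_congr fun x => ?_
  have hx : MeasurableSet (Prod.mk x ⁻¹' s) := measurable_prodMk_left hs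
  calc ∫⁻ y, s.indicator (g ∘ Prod.fst) (x, y) ∂κ x
      = ∫⁻ y, (Prod.mk x ⁻¹' s).indicator (fun _ => g x) y ∂κ x := rfl
    _ = _ := by rw [lintegral_indicator_const hx]; rfl

/-- A finer statistic stays sufficient. This is what lets the newest observation enter the history.
-/
lemma Sufficient.of_comp {f : X → T} {q : T → U} (hq : Measurable q) {μ ν : Measure X}
    (h : Sufficient (q ∘ f) μ ν) : Sufficient f μ ν := by
  obtain ⟨p, r, h⟩ := h
  exact ⟨p ∘ q, r ∘ q, h.measurable_left.comp hq, h.measurable_right.comp hq,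
    fun t => h.add_eq_one _, h.left_eq, h.right_eq⟩

lemma Sufficient.map {e : X → Y} (he : Measurable e) {f : Y → T} (hf : Measurable f)
    {μ ν : Measure X} (h : Sufficient (f ∘ e) μ ν) : Sufficient f (μ.map e) (ν.map e) := by
  obtain ⟨p, q, h⟩ := h
  refine ⟨p, q, h.measurable_left, h.measurable_right, h.add_eq_one, ?_, ?_⟩
  · rw [← Measure.map_add _ _ he, ← withDensity_comp_map he (h.measurable_left.comp hf)]
    exact congrArg (Measure.map e) h.left_eq
  · rw [← Measure.map_add _ _ he, ← withDensity_comp_map he (h.measurable_right.comp hf)]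
    exact congrArg (Measure.map e) h.right_eq

/-- A coordinate drawn from the same kernel under both measures leaves their likelihood ratio
unchanged. -/
lemma Sufficient.compProd {f : X → T} (hf : Measurable f) {μ ν : Measure X} [IsFiniteMeasure μ]
    [IsFiniteMeasure ν] (h : Sufficient f μ ν) (κ : Kernel X Y) [IsMarkovKernel κ] :
    Sufficient (f ∘ Prod.fst) (μ ⊗ₘ κ) (ν ⊗ₘ κ) := by
  obtain ⟨p, q, h⟩ := h
  refine ⟨p, q, h.measurable_left, h.measurable_right, h.add_eq_one, ?_, ?_⟩
  · have := h.left_eq ▸ (inferInstance : SFinite μ)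
    rw [← Measure.compProd_add_left, ← Function.comp_assoc,
      withDensity_comp_fst_compProd (h.measurable_left.comp hf), ← h.left_eq]
  · have := h.right_eq ▸ (inferInstance : SFinite ν)
    rw [← Measure.compProd_add_left, ← Function.comp_assoc,
      withDensity_comp_fst_compProd (h.measurable_right.comp hf), ← h.right_eq]

lemma sufficient_smul (f : X → T) (m : Measure X) {a b : ℝ≥0∞} (hab : a + b = 1) :
    Sufficient f (a • m) (b • m) := by
  refine ⟨fun _ => a, fun _ => b, measurable_const, measurable_const, fun _ => hab, ?_, ?_⟩ <;>
  · rw [← add_smul, hab, one_smul]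
    exact (withDensity_const _).symm

/-- The mixture of two kernels with the weights `p` and `q`. -/
noncomputable def mixKernel (p q : T → ℝ≥0∞) (κ₁ κ₂ : Kernel T A) [IsSFiniteKernel κ₁]
    [IsSFiniteKernel κ₂] : Kernel T A :=
  κ₁.withDensity (fun t _ => p t) + κ₂.withDensity (fun t _ => q t)

lemma mixKernel_apply {p q : T → ℝ≥0∞} (hp : Measurable p) (hq : Measurable q)
    (κ₁ κ₂ : Kernel T A) [IsSFiniteKernel κ₁] [IsSFiniteKernel κ₂] (t : T) :
    mixKernel p q κ₁ κ₂ t = p t • κ₁ t + q t • κ₂ t := by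
  rw [mixKernel, add_apply, Kernel.withDensity_apply _ (by fun_prop),
    Kernel.withDensity_apply _ (by fun_prop), withDensity_const, withDensity_const]

lemma isMarkovKernel_mixKernel {p q : T → ℝ≥0∞} (hp : Measurable p) (hq : Measurable q)
    (hpq : ∀ t, p t + q t = 1) (κ₁ κ₂ : Kernel T A) [IsMarkovKernel κ₁] [IsMarkovKernel κ₂] :
    IsMarkovKernel (mixKernel p q κ₁ κ₂) :=
  ⟨fun t => ⟨by simp [mixKernel_apply hp hq, hpq]⟩⟩

/-- Bayes' rule: given `x`, the hidden label is `μ` with probability `p (f x)` and `ν` with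
probability `q (f x)`, so averaging the two kernels with these weights gives the conditional law of
the new coordinate. -/
lemma IsPosterior.compProd_add_compProd {f : X → T} (hf : Measurable f) {μ ν : Measure X}
    [IsFiniteMeasure μ] [IsFiniteMeasure ν] {p q : T → ℝ≥0∞} (h : IsPosterior f μ ν p q)
    (κ₁ κ₂ : Kernel T A) [IsMarkovKernel κ₁] [IsMarkovKernel κ₂] :
    (μ ⊗ₘ κ₁.comap f hf) + (ν ⊗ₘ κ₂.comap f hf)
      = (μ + ν) ⊗ₘ (mixKernel p q κ₁ κ₂).comap f hf := by
  have := isMarkovKernel_mixKernel h.measurable_left h.measurable_right h.add_eq_one κ₁ κ₂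
  ext s hs
  rw [Measure.add_apply, Measure.compProd_apply hs, Measure.compProd_apply hs,
    Measure.compProd_apply hs]
  have h1 := Kernel.measurable_kernel_prodMk_left (κ := κ₁.comap f hf) hs
  have h2 := Kernel.measurable_kernel_prodMk_left (κ := κ₂.comap f hf) hs
  have hp := h.measurable_left
  have hq := h.measurable_right
  calc _ = ∫⁻ x, (p ∘ f) x * κ₁.comap f hf x (Prod.mk x ⁻¹' s) ∂(μ + ν)
        + ∫⁻ x, (q ∘ f) x * κ₂.comap f hf x (Prod.mk x ⁻¹' s) ∂(μ + ν) := by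
        congr 1
        · conv_lhs => rw [h.left_eq]
          exact lintegral_withDensity_eq_lintegral_mul _ (hp.comp hf) h1
        · conv_lhs => rw [h.right_eq]
          exact lintegral_withDensity_eq_lintegral_mul _ (hq.comp hf) h2
    _ = _ := by
        refine (lintegral_add_left ((hp.comp hf).mul h1) _).symm.trans ?_
        refine lintegral_congr fun x => ?_
        simp [Kernel.comap_apply, mixKernel_apply hp hq]

lemma map_prodMap_compProd_comap {μ : Measure X} [IsFiniteMeasure μ] {f : X → T}
    (hf : Measurable f) (κ : Kernel T A) [IsMarkovKernel κ] :
    (μ ⊗ₘ κ.comap f hf).map (Prod.map f id) = (μ.map f) ⊗ₘ κ := by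
  have hm : Measurable (Prod.map f (id : A → A)) := hf.prodMap measurable_id
  ext s hs
  rw [Measure.map_apply hm hs, Measure.compProd_apply (hm hs), Measure.compProd_apply hs,
    lintegral_map (Kernel.measurable_kernel_prodMk_left hs) hf]
  rfl

/-- When the second coordinate depends on the first only through `f`, a density between the images
of two joint laws under `f` is a density between the joint laws themselves. -/
lemma compProd_comap_eq_withDensity {f : X → T} (hf : Measurable f) {μ Q : Measure X}
    [IsFiniteMeasure μ] [IsFiniteMeasure Q] {p : T → ℝ≥0∞} (hp : Measurable p)
    (hμ : μ = Q.withDensity (p ∘ f)) (κ₁ κ : Kernel T A) [IsMarkovKernel κ₁] [IsMarkovKernel κ]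
    {g : T × A → ℝ≥0∞} (hg : Measurable g)
    (h : (μ.map f) ⊗ₘ κ₁ = ((Q.map f) ⊗ₘ κ).withDensity g) :
    μ ⊗ₘ κ₁.comap f hf = (Q ⊗ₘ κ.comap f hf).withDensity (g ∘ Prod.map f id) := by
  have hm : Measurable (Prod.map f (id : A → A)) := hf.prodMap measurable_id
  have hprod (B : Set T) (hB : MeasurableSet B) (C : Set A) (hC : MeasurableSet C) :
      ∫⁻ t in B, p t * κ₁ t C ∂(Q.map f) = ∫⁻ t in B, ∫⁻ a in C, g (t, a) ∂κ t ∂(Q.map f) := by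
    have h1 : (μ.map f ⊗ₘ κ₁) (B ×ˢ C) = ((Q.map f) ⊗ₘ κ).withDensity g (B ×ˢ C) := by rw [h]
    rw [withDensity_apply _ (hB.prod hC), Measure.setLIntegral_compProd hg hB hC,
      Measure.compProd_apply_prod hB hC] at h1
    rw [← h1]
    conv_rhs => rw [hμ, withDensity_comp_map hf hp]
    rw [restrict_withDensity hB, lintegral_withDensity_eq_lintegral_mul _ hp
      (κ₁.measurable_coe hC)]
    rfl
  refine Measure.ext_prod fun {B C} hB hC => ?_
  have hint : Measurable fun t => ∫⁻ a in C, g (t, a) ∂κ t := by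
    simp_rw [← lintegral_indicator hC]
    have : Measurable (Function.uncurry fun t a => C.indicator (fun a => g (t, a)) a) := by
      have h2 : (Function.uncurry fun t a => C.indicator (fun a => g (t, a)) a)
          = (Set.univ ×ˢ C).indicator g := by
        ext ⟨t, a⟩
        by_cases ha : a ∈ C <;> simp [ha]
      rw [h2]
      exact hg.indicator (MeasurableSet.univ.prod hC)
    exact this.lintegral_kernel_prod_right
  -- The integrated identity on `T` becomes pointwise almost everywhere there. Pulled back along
  -- `f`, it can be integrated over every measurable set of `X`, not only over preimages under `f`.
  have hae : (fun t => p t * κ₁ t C) =ᵐ[Q.map f] fun t => ∫⁻ a in C, g (t, a) ∂κ t :=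
    ae_eq_of_forall_setLIntegral_eq_of_sigmaFinite (hp.mul (κ₁.measurable_coe hC)) hint
      fun B hB _ => hprod B hB C hC
  have hae' := ae_of_ae_map hf.aemeasurable hae
  rw [withDensity_apply _ (hB.prod hC), Measure.setLIntegral_compProd (hg.comp hm) hB hC,
    Measure.compProd_apply_prod hB hC]
  conv_lhs => rw [hμ]
  rw [restrict_withDensity hB, lintegral_withDensity_eq_lintegral_mul _ (hp.comp hf)
    ((κ₁.comap f hf).measurable_coe hC)]
  exact lintegral_congr_ae (ae_restrict_of_ae hae')

lemma exists_density_of_add (μ ν : Measure X) [IsFiniteMeasure μ] [IsFiniteMeasure ν] :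
    Sufficient id μ ν := by
  have hμ : μ ≪ μ + ν := Measure.absolutelyContinuous_of_le (Measure.le_add_right le_rfl)
  have hle : μ.rnDeriv (μ + ν) ≤ᵐ[μ + ν] 1 :=
    Measure.rnDeriv_le_one_of_le (Measure.le_add_right le_rfl)
  -- Truncating at `1` changes the density only on a null set and makes the two densities add up to
  -- `1` everywhere, as the kernels built from them must be Markov at every point.
  have hm : Measurable fun x => min (μ.rnDeriv (μ + ν) x) 1 :=
    (Measure.measurable_rnDeriv _ _).min measurable_const
  have h1 : μ = (μ + ν).withDensity fun x => min (μ.rnDeriv (μ + ν) x) 1 := by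
    conv_lhs => rw [← Measure.withDensity_rnDeriv_eq _ _ hμ]
    refine withDensity_congr_ae ?_
    filter_upwards [hle] with x hx
    exact (min_eq_left hx).symm
  refine ⟨_, fun x => 1 - min (μ.rnDeriv (μ + ν) x) 1, hm, measurable_const.sub hm,
    fun x => add_tsub_cancel_of_le (min_le_right _ _), h1, ?_⟩
  have h2 : μ + ν = (μ + ν).withDensity (fun x => min (μ.rnDeriv (μ + ν) x) 1)
      + (μ + ν).withDensity (fun x => 1 - min (μ.rnDeriv (μ + ν) x) 1) := by
    rw [← withDensity_add_left hm]
    have : (fun x => min (μ.rnDeriv (μ + ν) x) 1) + (fun x => 1 - min (μ.rnDeriv (μ + ν) x) 1)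
        = 1 := funext fun x => add_tsub_cancel_of_le (min_le_right _ _)
    rw [this, withDensity_one]
  rw [← h1] at h2
  exact (Measure.add_right_inj _ _ _).1 h2

/-- The kernels may differ, but both look only at `f`. So the new likelihood ratio can be computed
for the images in `T × A` and lifted back. -/
lemma Sufficient.compProd_comap {f : X → T} (hf : Measurable f) {μ ν : Measure X}
    [IsFiniteMeasure μ] [IsFiniteMeasure ν] (h : Sufficient f μ ν)
    (κ₁ κ₂ : Kernel T A) [IsMarkovKernel κ₁] [IsMarkovKernel κ₂] :
    Sufficient (Prod.map f id) (μ ⊗ₘ κ₁.comap f hf) (ν ⊗ₘ κ₂.comap f hf) := by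
  obtain ⟨p, q, h⟩ := h
  have := isMarkovKernel_mixKernel h.measurable_left h.measurable_right h.add_eq_one κ₁ κ₂
  have hm : Measurable (Prod.map f (id : A → A)) := hf.prodMap measurable_id
  have hadd := h.compProd_add_compProd hf κ₁ κ₂
  have hadd' : (μ.map f ⊗ₘ κ₁) + (ν.map f ⊗ₘ κ₂)
      = (μ + ν).map f ⊗ₘ mixKernel p q κ₁ κ₂ := by
    simp_rw [← map_prodMap_compProd_comap hf]
    rw [← hadd, Measure.map_add _ _ hm]
  obtain ⟨g₁, g₂, hg⟩ := exists_density_of_add (μ.map f ⊗ₘ κ₁) (ν.map f ⊗ₘ κ₂)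
  refine ⟨g₁, g₂, hg.measurable_left, hg.measurable_right, hg.add_eq_one, ?_, ?_⟩
  · rw [hadd]
    exact compProd_comap_eq_withDensity hf h.measurable_left h.left_eq _ _ hg.measurable_left
      (hadd' ▸ hg.left_eq)
  · rw [hadd]
    exact compProd_comap_eq_withDensity hf h.measurable_right h.right_eq _ _ hg.measurable_right
      (hadd' ▸ hg.right_eq)

end Sufficient

end TGRL

/-! ### The trajectory split into environment moves and student actions. -/

namespace TGRL

noncomputable section

variable {S Ω Ωp A : Type*}

/-- What has happened before the action at time `t`: the steps before `t`, and the state and the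
observations at time `t`. -/
abbrev Pre (S Ω Ωp A : Type*) (t : ℕ) : Type _ := (Fin t → Step S Ω Ωp A) × (S × (Ω × Ωp))

/-- The part of a trajectory before the action at time `t`. -/
def pre (t : ℕ) (x : ℕ → Step S Ω Ωp A) : Pre S Ω Ωp A t := (fun i => x i, (x t).1)

/-- The history that the student sees at time `t`. -/
def preHist (t : ℕ) (y : Pre S Ω Ωp A t) : Hist Ω A t :=
  (fun i => ((y.1 i).ob, (y.1 i).action), y.2.2.1)

/-- The steps `0, …, t`, obtained by appending the action at time `t`. -/
def appendAction (t : ℕ) (y : Pre S Ω Ωp A t × A) : Fin (t + 1) → Step S Ω Ωp A :=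
  Fin.snoc (α := fun _ => Step S Ω Ωp A) y.1.1 (y.1.2, y.2)

/-- What the student knows after the action at time `t`. -/
def pastHist (t : ℕ) (z : Fin (t + 1) → Step S Ω Ωp A) : Hist Ω A t × A :=
  (preHist t (fun i => z i.castSucc, (z (Fin.last t)).1), (z (Fin.last t)).action)

/-- The history before the last observation, with the action that follows it. -/
def Hist.pop (t : ℕ) (h : Hist Ω A (t + 1)) : Hist Ω A t × A :=
  ((fun i => h.1 i.castSucc, (h.1 (Fin.last t)).1), (h.1 (Fin.last t)).2)

lemma pastHist_comp_appendAction (t : ℕ) :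
    (pastHist t : (Fin (t + 1) → Step S Ω Ωp A) → _) ∘ appendAction t
      = Prod.map (preHist t) id := by
  funext y
  simp [pastHist, appendAction, preHist, Step.action, Prod.map]

lemma pastHist_comp_fst (t : ℕ) :
    (pastHist t : (Fin (t + 1) → Step S Ω Ωp A) → _) ∘ Prod.fst
      = Hist.pop t ∘ preHist (t + 1) := rfl

lemma appendAction_pre (t : ℕ) (x : ℕ → Step S Ω Ωp A) :
    appendAction t (pre t x, (x t).2) = fun i : Fin (t + 1) => x i := by
  funext i
  refine Fin.lastCases ?_ (fun i => ?_) i <;> simp [appendAction, pre]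

variable [MeasurableSpace S] [MeasurableSpace Ω] [MeasurableSpace Ωp] [MeasurableSpace A]

@[fun_prop]
lemma measurable_pre (t : ℕ) :
    Measurable (pre t : (ℕ → Step S Ω Ωp A) → Pre S Ω Ωp A t) := by
  unfold pre
  fun_prop

@[fun_prop]
lemma measurable_preHist (t : ℕ) :
    Measurable (preHist t : Pre S Ω Ωp A t → Hist Ω A t) := by
  unfold preHist Step.ob Step.action
  fun_prop

@[fun_prop]
lemma measurable_appendAction (t : ℕ) :
    Measurable (appendAction t : Pre S Ω Ωp A t × A → (Fin (t + 1) → Step S Ω Ωp A)) := by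
  refine measurable_pi_iff.2 fun i => ?_
  refine Fin.lastCases ?_ (fun i => ?_) i
  · simp only [appendAction, Fin.snoc_last]
    fun_prop
  · simp only [appendAction, Fin.snoc_castSucc]
    fun_prop

@[fun_prop]
lemma measurable_pastHist (t : ℕ) :
    Measurable (pastHist t : (Fin (t + 1) → Step S Ω Ωp A) → Hist Ω A t × A) := by
  unfold pastHist Step.action
  fun_prop

@[fun_prop]
lemma measurable_pop (t : ℕ) :
    Measurable (Hist.pop t : Hist Ω A (t + 1) → Hist Ω A t × A) := by
  unfold Hist.pop
  fun_prop

namespace POMDP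

variable (M : POMDP S Ω Ωp A) (π : Policy Ω A)

/-- The law of the next state and observations given the steps `0, …, t`. -/
def envStep (t : ℕ) : Kernel (Fin (t + 1) → Step S Ω Ωp A) (S × (Ω × Ωp)) :=
  (M.trans.comap (fun z => ((z (Fin.last t)).1.1, (z (Fin.last t)).2)) (by fun_prop)) ⊗ₖ
    (M.obs.comap Prod.snd measurable_snd)

instance (t : ℕ) : IsMarkovKernel (M.envStep t) := by
  unfold envStep
  infer_instance

instance : IsProbabilityMeasure (M.law π) := by
  unfold law
  infer_instance

lemma map_zero_law : (M.law π).map (fun x => x 0) = M.firstStep π := by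
  have h : (M.law π).map (Preorder.frestrictLe 0)
      = (M.firstStep π).map
        (MeasurableEquiv.piUnique (fun _ : Finset.Iic 0 => Step S Ω Ωp A)).symm := by
    rw [law, Kernel.trajMeasure, Measure.map_comp _ _ (by fun_prop),
      Kernel.traj_map_frestrictLe_of_le le_rfl, Measure.deterministic_comp_eq_map]
    exact Measure.map_id
  have h2 : (fun x : ℕ → Step S Ω Ωp A => x 0)
      = (MeasurableEquiv.piUnique (fun _ : Finset.Iic 0 => Step S Ω Ωp A))
        ∘ Preorder.frestrictLe 0 := rfl
  rw [h2, ← Measure.map_map (by fun_prop) (by fun_prop), h, Measure.map_map (by fun_prop)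
    (by fun_prop), MeasurableEquiv.self_comp_symm, Measure.map_id]

/-- Before the action at time `0`. -/
lemma map_pre_zero_law : (M.law π).map (pre 0)
    = (M.init ⊗ₘ M.obs).map (fun p => (Fin.elim0, p)) := by
  have h : (pre 0 : (ℕ → Step S Ω Ωp A) → _)
      = (fun p => (Fin.elim0, p)) ∘ Prod.fst ∘ fun x => x 0 := by
    funext x
    exact Prod.ext (Subsingleton.elim _ _) rfl
  rw [h, ← Measure.map_map (by fun_prop) (by fun_prop),
    ← Measure.map_map (by fun_prop) (by fun_prop), map_zero_law, firstStep]
  exact congrArg _ (Measure.fst_compProd _ _)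

lemma map_comap_compProd {X Y Z : Type*} [MeasurableSpace X] [MeasurableSpace Y]
    [MeasurableSpace Z] {μ : Measure X} [IsFiniteMeasure μ] {f : X → Y} (hf : Measurable f)
    (κ : Kernel X Z) [IsMarkovKernel κ] (κ' : Kernel Y Z) [IsMarkovKernel κ']
    (h : κ = κ'.comap f hf) :
    (μ ⊗ₘ κ).map (fun p => (f p.1, p.2)) = (μ.map f) ⊗ₘ κ' := by
  subst h
  exact map_prodMap_compProd_comap hf κ'

lemma map_step_law_zero : (M.law π).map (fun x => (pre 0 x, (x 0).2))
    = (M.law π).map (pre 0) ⊗ₘ (π.act 0).comap (preHist 0) (measurable_preHist 0) := by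
  have h : (fun x : ℕ → Step S Ω Ωp A => (pre 0 x, (x 0).2))
      = (fun p => ((Fin.elim0, p.1), p.2)) ∘ fun x => x 0 := by
    funext x
    exact Prod.ext (Prod.ext (Subsingleton.elim _ _) rfl) rfl
  rw [map_pre_zero_law, h, ← Measure.map_map (by fun_prop) (by fun_prop), map_zero_law, firstStep]
  refine map_comap_compProd (f := fun p : S × (Ω × Ωp) => ((Fin.elim0, p) : Pre S Ω Ωp A 0))
    (by fun_prop) _ _ ?_
  ext p : 1
  simp only [Kernel.comap_apply]
  congr 1
  exact Prod.ext (Subsingleton.elim _ _) rfl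

/-- `nextStep` is an environment move followed by an action. Reassociating the product isolates the
policy in the last factor. -/
lemma map_step_law_succ_aux (n : ℕ) :
    (M.law π).map (fun x => (pre (n + 1) x, (x (n + 1)).2))
      = ((M.law π).map (fun x => fun i : Fin (n + 1) => x i) ⊗ₘ M.envStep n)
        ⊗ₘ (π.act (n + 1)).comap (preHist (n + 1)) (measurable_preHist (n + 1)) := by
  let e : ((_ : Finset.Iic n) → Step S Ω Ωp A) → (Fin (n + 1) → Step S Ω Ωp A) :=
    fun z i => z ⟨i, Finset.mem_Iic.2 (Nat.lt_succ_iff.1 i.2)⟩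
  have he : Measurable e := by fun_prop
  have h := Kernel.map_frestrictLe_trajMeasure_compProd_eq_map_trajMeasure
    (X := fun _ => Step S Ω Ωp A) (μ₀ := M.firstStep π) (κ := M.nextStep π) (a := n)
  change (M.law π).map _ ⊗ₘ _ = (M.law π).map _ at h
  have h2 : (fun x : ℕ → Step S Ω Ωp A => (pre (n + 1) x, (x (n + 1)).2))
      = (fun p => ((e p.1.1, p.1.2), p.2)) ∘ MeasurableEquiv.prodAssoc.symm ∘
        (fun x => (Preorder.frestrictLe n x, x (n + 1))) := rfl
  rw [h2, ← Measure.map_map (by fun_prop) (by fun_prop),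
    ← Measure.map_map (by fun_prop) (by fun_prop), ← h, nextStep,
    Measure.compProd_assoc]
  refine (map_comap_compProd (f := fun p : _ × (S × (Ω × Ωp)) => (e p.1, p.2)) (by fun_prop) _
    ((π.act (n + 1)).comap (preHist (n + 1)) (measurable_preHist (n + 1))) rfl).trans ?_
  refine congrArg (fun m : Measure (Pre S Ω Ωp A (n + 1)) => m ⊗ₘ _) ?_
  refine (map_comap_compProd he _ (M.envStep n) ?_).trans ?_
  · ext z : 1
    ext s hs
    simp only [Kernel.comap_apply, envStep, Kernel.compProd_apply hs]
    rfl
  · rw [Measure.map_map he (by fun_prop)]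
    rfl

lemma map_pre_succ_law (n : ℕ) : (M.law π).map (pre (n + 1))
    = (M.law π).map (fun x => fun i : Fin (n + 1) => x i) ⊗ₘ M.envStep n := by
  have h := congrArg Measure.fst (M.map_step_law_succ_aux π n)
  rw [Measure.fst_compProd, Measure.fst, Measure.map_map (by fun_prop) (by fun_prop)] at h
  exact h

/-- The action at time `t` is drawn from the policy at the history at time `t`. -/
lemma map_step_law (t : ℕ) : (M.law π).map (fun x => (pre t x, (x t).2))
    = (M.law π).map (pre t) ⊗ₘ (π.act t).comap (preHist t) (measurable_preHist t) := by
  cases t with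
  | zero => exact M.map_step_law_zero π
  | succ n => rw [map_pre_succ_law, map_step_law_succ_aux]

lemma map_past_law (t : ℕ) : (M.law π).map (fun x => fun i : Fin (t + 1) => x i)
    = ((M.law π).map (fun x => (pre t x, (x t).2))).map (appendAction t) := by
  rw [Measure.map_map (by fun_prop) (by fun_prop)]
  congr 1
  funext x
  exact (appendAction_pre t x).symm

/-! ### Mixing two policies. -/

variable {a b : ℝ≥0∞}

/-- The student's history is sufficient for telling two policies apart: states and privileged
observations carry no further information. -/
lemma sufficient_preHist (π₁ π₂ : Policy Ω A) (hab : a + b = 1) (t : ℕ) :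
    Sufficient (preHist t) (a • (M.law π₁).map (pre t)) (b • (M.law π₂).map (pre t)) := by
  have ha : a ≠ ∞ := fun h => by simp [h] at hab
  have hb : b ≠ ∞ := fun h => by simp [h] at hab
  have key (m : Measure (ℕ → Step S Ω Ωp A)) [IsProbabilityMeasure m] (c : ℝ≥0∞) (hc : c ≠ ∞) :
      ∀ t, IsFiniteMeasure (c • m.map (pre t)) := fun t => Measure.smul_finite _ hc
  have f1 := key (M.law π₁) a ha
  have f2 := key (M.law π₂) b hb
  induction t with
  | zero =>
    rw [map_pre_zero_law, map_pre_zero_law]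
    exact sufficient_smul _ _ hab
  | succ n ih =>
    -- The two policies use different action kernels, but both read only the history.
    have h1 := ih.compProd_comap (measurable_preHist n) (π₁.act n) (π₂.act n)
    rw [← pastHist_comp_appendAction] at h1
    -- The environment kernel is common to both policies, so it carries no information about which
    -- one acts.
    have h2 := (h1.map (measurable_appendAction n) (measurable_pastHist n)).compProd
      (measurable_pastHist n) (M.envStep n)
    rw [pastHist_comp_fst] at h2
    -- The statistic so far lacks the observation at time `n + 1`; it is a function of the full
    -- history.
    have h3 := h2.of_comp (measurable_pop n)
    simpa only [Measure.compProd_smul_left, ← map_step_law, Measure.map_smul, ← map_past_law,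
      ← map_pre_succ_law] using h3

/-- A policy that realizes the mixture of two policies with the weights `a` and `b`. -/
def mixPolicy (π₁ π₂ : Policy Ω A) (hab : a + b = 1) : Policy Ω A where
  act t := mixKernel (M.sufficient_preHist π₁ π₂ hab t).choose
    (M.sufficient_preHist π₁ π₂ hab t).choose_spec.choose (π₁.act t) (π₂.act t)
  act_markov t :=
    have h := (M.sufficient_preHist π₁ π₂ hab t).choose_spec.choose_spec
    isMarkovKernel_mixKernel h.measurable_left h.measurable_right h.add_eq_one _ _

lemma map_step_mixPolicy_aux (π₁ π₂ : Policy Ω A) (hab : a + b = 1) (t : ℕ)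
    (h : (M.law (M.mixPolicy π₁ π₂ hab)).map (pre t)
      = a • (M.law π₁).map (pre t) + b • (M.law π₂).map (pre t)) :
    (M.law (M.mixPolicy π₁ π₂ hab)).map (fun x => (pre t x, (x t).2))
      = a • (M.law π₁).map (fun x => (pre t x, (x t).2))
        + b • (M.law π₂).map (fun x => (pre t x, (x t).2)) := by
  have ha : a ≠ ∞ := fun h => by simp [h] at hab
  have hb : b ≠ ∞ := fun h => by simp [h] at hab
  have f1 : IsFiniteMeasure (a • (M.law π₁).map (pre t)) := Measure.smul_finite _ ha
  have f2 : IsFiniteMeasure (b • (M.law π₂).map (pre t)) := Measure.smul_finite _ hb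
  rw [map_step_law, map_step_law, map_step_law, h, ← Measure.compProd_smul_left,
    ← Measure.compProd_smul_left]
  exact ((M.sufficient_preHist π₁ π₂ hab t).choose_spec.choose_spec.compProd_add_compProd
    (measurable_preHist t) (π₁.act t) (π₂.act t)).symm

/-- Mixtures propagate in time: through the action by the choice of posterior weights, through the
environment because its kernel acts linearly on measures and does not involve the policy. -/
lemma map_pre_mixPolicy (π₁ π₂ : Policy Ω A) (hab : a + b = 1) (t : ℕ) :
    (M.law (M.mixPolicy π₁ π₂ hab)).map (pre t)
      = a • (M.law π₁).map (pre t) + b • (M.law π₂).map (pre t) := by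
  induction t with
  | zero => rw [map_pre_zero_law, map_pre_zero_law, map_pre_zero_law, ← add_smul, hab, one_smul]
  | succ n ih =>
    have ha : a ≠ ∞ := fun h => by simp [h] at hab
    have hb : b ≠ ∞ := fun h => by simp [h] at hab
    have h := congrArg (Measure.map (appendAction n)) (M.map_step_mixPolicy_aux π₁ π₂ hab n ih)
    rw [Measure.map_add _ _ (by fun_prop), Measure.map_smul, Measure.map_smul, ← map_past_law,
      ← map_past_law, ← map_past_law] at h
    have f1 : IsFiniteMeasure (a • (M.law π₁).map fun x => fun i : Fin (n + 1) => x i) :=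
      Measure.smul_finite _ ha
    have f2 : IsFiniteMeasure (b • (M.law π₂).map fun x => fun i : Fin (n + 1) => x i) :=
      Measure.smul_finite _ hb
    rw [map_pre_succ_law, map_pre_succ_law, map_pre_succ_law, h, Measure.compProd_add_left,
      Measure.compProd_smul_left, Measure.compProd_smul_left]

/-- The law of each step under the mixed policy is the mixture of the laws. -/
lemma map_eval_mixPolicy (π₁ π₂ : Policy Ω A) (hab : a + b = 1) (t : ℕ) :
    (M.law (M.mixPolicy π₁ π₂ hab)).map (fun x => x t)
      = a • (M.law π₁).map (fun x => x t) + b • (M.law π₂).map (fun x => x t) := by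
  have h := congrArg (Measure.map fun p : Pre S Ω Ωp A t × A => ((p.1.2, p.2) : Step S Ω Ωp A))
    (M.map_step_mixPolicy_aux π₁ π₂ hab t (M.map_pre_mixPolicy π₁ π₂ hab t))
  rw [Measure.map_add _ _ (by fun_prop), Measure.map_smul, Measure.map_smul,
    Measure.map_map (by fun_prop) (by fun_prop), Measure.map_map (by fun_prop) (by fun_prop),
    Measure.map_map (by fun_prop) (by fun_prop)] at h
  exact h

end POMDP

/-! ### Lagrangian duality for two objectives with convex range. -/

/-- A Lagrange multiplier for the maximization of `G` subject to `η ≤ J` under Slater's condition,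
for a pair of objectives with convex range. -/
lemma exists_multiplier {ι : Type*} {J G : ι → ℝ}
    (hconv : ∀ i j, ∀ a b : ℝ, 0 ≤ a → 0 ≤ b → a + b = 1 →
      ∃ k, J k = a * J i + b * J j ∧ G k = a * G i + b * G j)
    {η p : ℝ} (hslater : ∃ i, η < J i) (hp : ∀ i, η ≤ J i → G i ≤ p) :
    ∃ l, 0 ≤ l ∧ ∀ i, G i + l * (J i - η) ≤ p := by
  -- A strictly feasible `i` demands exactly that `l` be at most its element of `R`. The infimum is
  -- the largest `l` that all of them allow.
  let R : Set ℝ := (fun i => (p - G i) / (J i - η)) '' {i | η < J i}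
  have hR0 : ∀ r ∈ R, 0 ≤ r := by
    rintro _ ⟨i, hi, rfl⟩
    exact div_nonneg (sub_nonneg.2 (hp i (le_of_lt hi))) (sub_nonneg.2 (le_of_lt hi))
  have hRne : R.Nonempty := by
    obtain ⟨i, hi⟩ := hslater
    exact ⟨_, i, hi, rfl⟩
  refine ⟨sInf R, Real.sInf_nonneg hR0, fun i => ?_⟩
  rcases lt_trichotomy (J i) η with hi | hi | hi
  · have hpos : 0 < η - J i := sub_pos.2 hi
    have hle : (G i - p) / (η - J i) ≤ sInf R := by
      refine le_csInf hRne ?_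
      rintro _ ⟨j, hj, rfl⟩
      have hj' : 0 < J j - η := sub_pos.2 hj
      have hd : 0 < J j - J i := by linarith
      -- The weights are chosen to put `J k` exactly at `η`. Feasibility of `k` then says that the
      -- lower bound on `l` demanded by `i` is below the upper bound demanded by `j`.
      obtain ⟨k, hk1, hk2⟩ := hconv i j ((J j - η) / (J j - J i)) ((η - J i) / (J j - J i))
        (by positivity) (by positivity) (by field_simp; ring)
      have hJ : J k = η := by rw [hk1]; field_simp; ring
      have hG := hp k hJ.ge
      have hG' : ((J j - η) * G i + (η - J i) * G j) / (J j - J i) ≤ p := by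
        refine le_trans (le_of_eq ?_) hG
        rw [hk2]; ring
      rw [div_le_iff₀ hd] at hG'
      rw [div_le_div_iff₀ hpos hj']
      nlinarith
    rw [div_le_iff₀ hpos] at hle
    nlinarith
  · simpa [hi] using hp i hi.ge
  · have hpos : 0 < J i - η := sub_pos.2 hi
    have hle : sInf R ≤ (p - G i) / (J i - η) := csInf_le ⟨0, hR0⟩ ⟨i, hi, rfl⟩
    rw [le_div_iff₀ hpos] at hle
    linarith

lemma isLeast_dual {ι : Type*} {J G : ι → ℝ}
    (hconv : ∀ i j, ∀ a b : ℝ, 0 ≤ a → 0 ≤ b → a + b = 1 →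
      ∃ k, J k = a * J i + b * J j ∧ G k = a * G i + b * G j)
    {C : ℝ} (hC : ∀ i, G i ≤ C) {η : ℝ} (hslater : ∃ i, η < J i) :
    IsLeast ((fun l : ℝ => ⨆ i, ((G i + l * (J i - η) : ℝ) : EReal)) '' Set.Ici 0)
      (⨆ (i) (_ : η ≤ J i), (G i : EReal)) := by
  have hweak : (⨆ (i) (_ : η ≤ J i), (G i : EReal)) ∈ lowerBounds
      ((fun l : ℝ => ⨆ i, ((G i + l * (J i - η) : ℝ) : EReal)) '' Set.Ici 0) := by
    rintro _ ⟨l, hl, rfl⟩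
    refine iSup₂_le fun i hi => le_iSup_of_le i (EReal.coe_le_coe_iff.2 ?_)
    have := mul_nonneg (Set.mem_Ici.1 hl) (sub_nonneg.2 hi)
    linarith
  refine ⟨?_, hweak⟩
  have hle : ∀ i, η ≤ J i → (G i : EReal) ≤ ⨆ (i) (_ : η ≤ J i), (G i : EReal) :=
    fun i hi => le_iSup₂_of_le i hi le_rfl
  have htop : (⨆ (i) (_ : η ≤ J i), (G i : EReal)) ≤ (C : EReal) :=
    iSup₂_le fun i _ => EReal.coe_le_coe_iff.2 (hC i)
  obtain ⟨i₀, hi₀⟩ := hslater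
  -- The primal value is a real number: bounded above by `C`, and below by the Slater point.
  obtain ⟨p, hp⟩ : ∃ p : ℝ, (p : EReal) = ⨆ (i) (_ : η ≤ J i), (G i : EReal) :=
    ⟨_, EReal.coe_toReal (ne_top_of_le_ne_top (EReal.coe_ne_top C) htop)
      (ne_bot_of_le_ne_bot (EReal.coe_ne_bot (G i₀)) (hle i₀ hi₀.le))⟩
  obtain ⟨l, hl, hlp⟩ := exists_multiplier hconv ⟨i₀, hi₀⟩
    (fun i hi => EReal.coe_le_coe_iff.1 (hp ▸ hle i hi))
  refine ⟨l, hl, le_antisymm (iSup_le fun i => ?_) (hweak ⟨l, hl, rfl⟩)⟩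
  rw [← hp]
  exact EReal.coe_le_coe_iff.2 (hlp i)

/-! ### Discounted sums. -/

lemma summable_weight {γ : ℝ} {H : ℕ∞} (hγ0 : 0 ≤ γ) (hH : H = ⊤ → γ < 1) :
    Summable (weight γ H) := by
  induction H using ENat.recTopCoe with
  | top =>
    have h : weight γ ⊤ = fun t => γ ^ t := by
      funext t
      simp [weight]
    rw [h]
    exact summable_geometric_of_lt_one hγ0 (hH rfl)
  | coe n =>
    -- The horizon is inclusive, so times `0, …, n` carry weight. The sum is finite and `γ = 1` is
    -- harmless.
    refine summable_of_ne_finset_zero (s := Finset.range (n + 1)) fun t ht => ?_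
    have : ¬ t ≤ n := by simpa [Nat.lt_succ_iff] using ht
    simp [weight, this]

lemma integral_tsum_mul {X : Type*} [MeasurableSpace X] {P : Measure X} [IsProbabilityMeasure P]
    {w : ℕ → ℝ} (hw : Summable w) {f : ℕ → X → ℝ} (hf : ∀ t, Measurable (f t)) {C : ℝ}
    (hC : ∀ t x, |f t x| ≤ C) :
    ∫ x, ∑' t, w t * f t x ∂P = ∑' t, w t * ∫ x, f t x ∂P := by
  have hint (t : ℕ) : Integrable (f t) P :=
    .of_bound (hf t).aestronglyMeasurable C (.of_forall (hC t))
  rw [← integral_tsum_of_summable_integral_norm (fun t => (hint t).const_mul (w t))]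
  · simp_rw [integral_const_mul]
  · refine Summable.of_nonneg_of_le (fun t => integral_nonneg fun x => norm_nonneg _)
      (fun t => ?_) (hw.abs.mul_right C)
    have hle : ∀ x, ‖w t * f t x‖ ≤ |w t| * C := fun x => by
      rw [Real.norm_eq_abs, abs_mul]
      exact mul_le_mul_of_nonneg_left (hC t x) (abs_nonneg _)
    calc ∫ x, ‖w t * f t x‖ ∂P ≤ ∫ _, |w t| * C ∂P :=
          integral_mono ((hint t).const_mul _).norm (integrable_const _) hle
      _ = |w t| * C := by simp

/-! ### The objectives as functionals of the one-step laws. -/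

namespace POMDP

variable (M : POMDP S Ω Ωp A) (w : ℕ → ℝ) (g : Step S Ω Ωp A → ℝ) (π : Policy Ω A)

/-- The discounted sum of the expectations of `g` at the successive steps. -/
def stepSum : ℝ := ∑' t, w t * ∫ x, g (x t) ∂(M.law π)

variable {w g}

lemma abs_integral_step_le {C : ℝ} (hC : ∀ y, |g y| ≤ C) (t : ℕ) :
    |∫ x, g (x t) ∂(M.law π)| ≤ C := by
  simpa using norm_integral_le_of_norm_le_const (μ := M.law π) (f := fun x => g (x t))
    (.of_forall fun x => hC (x t))

lemma summable_stepSum (hw : Summable w) {C : ℝ} (hC : ∀ y, |g y| ≤ C) :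
    Summable fun t => w t * ∫ x, g (x t) ∂(M.law π) := by
  refine Summable.of_norm_bounded (hw.abs.mul_right C) fun t => ?_
  rw [Real.norm_eq_abs, abs_mul]
  exact mul_le_mul_of_nonneg_left (M.abs_integral_step_le π hC t) (abs_nonneg _)

lemma stepSum_le (hw : Summable w) {C : ℝ} (hC : ∀ y, |g y| ≤ C) :
    M.stepSum w g π ≤ ∑' t, |w t| * C := by
  refine (M.summable_stepSum π hw hC).tsum_le_tsum (fun t => ?_) (hw.abs.mul_right C)
  refine (le_abs_self _).trans ?_
  rw [abs_mul]
  exact mul_le_mul_of_nonneg_left (M.abs_integral_step_le π hC t) (abs_nonneg _)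

lemma integrable_step (hg : Measurable g) {C : ℝ} (hC : ∀ y, |g y| ≤ C) (t : ℕ) :
    Integrable (fun x => g (x t)) (M.law π) :=
  .of_bound (hg.comp (measurable_pi_apply t)).aestronglyMeasurable C (.of_forall fun x => hC (x t))

lemma stepSum_sub_mul (hw : Summable w) (hg : Measurable g) {C : ℝ} (hC : ∀ y, |g y| ≤ C)
    {f : Step S Ω Ωp A → ℝ} (hf : Measurable f) {D : ℝ} (hD : ∀ y, |f y| ≤ D) (α : ℝ) :
    M.stepSum w (fun y => g y - α * f y) π = M.stepSum w g π - α * M.stepSum w f π := by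
  unfold stepSum
  rw [← tsum_mul_left, ← (M.summable_stepSum π hw hC).tsum_sub
    ((M.summable_stepSum π hw hD).mul_left α)]
  refine tsum_congr fun t => ?_
  rw [integral_sub (M.integrable_step π hg hC t) ((M.integrable_step π hf hD t).const_mul α),
    integral_const_mul]
  ring

lemma stepSum_mixPolicy (hw : Summable w) (hg : Measurable g) {C : ℝ} (hC : ∀ y, |g y| ≤ C)
    (π₁ π₂ : Policy Ω A) {a b : ℝ≥0∞} (hab : a + b = 1) :
    M.stepSum w g (M.mixPolicy π₁ π₂ hab)
      = a.toReal * M.stepSum w g π₁ + b.toReal * M.stepSum w g π₂ := by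
  have ha : a ≠ ∞ := fun h => by simp [h] at hab
  have hb : b ≠ ∞ := fun h => by simp [h] at hab
  unfold stepSum
  rw [← tsum_mul_left, ← tsum_mul_left, ← ((M.summable_stepSum π₁ hw hC).mul_left _).tsum_add
    ((M.summable_stepSum π₂ hw hC).mul_left _)]
  refine tsum_congr fun t => ?_
  have hmap (π : Policy Ω A) :
      ∫ x, g (x t) ∂(M.law π) = ∫ y, g y ∂((M.law π).map fun x => x t) :=
    (integral_map (measurable_pi_apply t).aemeasurable hg.aestronglyMeasurable).symm
  have hint (π : Policy Ω A) : Integrable g ((M.law π).map fun x => x t) :=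
    (integrable_map_measure hg.aestronglyMeasurable (measurable_pi_apply t).aemeasurable).2
      (M.integrable_step π hg hC t)
  rw [hmap, hmap, hmap, map_eval_mixPolicy, integral_add_measure ((hint _).smul_measure ha)
    ((hint _).smul_measure hb), integral_smul_measure, integral_smul_measure]
  simp only [smul_eq_mul]
  ring

/-- The action may be integrated out at the history. -/
lemma integral_step_eq {ℓ : Ωp → A → ℝ} (hℓ : Measurable fun p : Ωp × A => ℓ p.1 p.2) {C : ℝ}
    (hC : ∀ o a, |ℓ o a| ≤ C) (t : ℕ) :
    ∫ x, ℓ (x t).priv (x t).action ∂(M.law π)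
      = ∫ x, ∫ a, ℓ (x t).priv a ∂(π.act t (hist t x)) ∂(M.law π) := by
  have hm : Measurable fun z : Pre S Ω Ωp A t × A => ℓ z.1.2.2.2 z.2 :=
    hℓ.comp (f := fun z : Pre S Ω Ωp A t × A => (z.1.2.2.2, z.2)) (by fun_prop)
  have h1 : ∫ x, ℓ (x t).priv (x t).action ∂(M.law π)
      = ∫ z, ℓ z.1.2.2.2 z.2 ∂((M.law π).map fun x => (pre t x, (x t).2)) :=
    (integral_map ((measurable_pre t).prodMk (measurable_pi_apply t).snd).aemeasurable
      hm.aestronglyMeasurable).symm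
  rw [h1, map_step_law, Measure.integral_compProd
    (.of_bound hm.aestronglyMeasurable C (.of_forall fun z => hC _ _)),
    integral_map (measurable_pre t).aemeasurable]
  · rfl
  · exact (hm.stronglyMeasurable.integral_kernel_prod_right'
      (κ := (π.act t).comap (preHist t) (measurable_preHist t))).aestronglyMeasurable

variable {μ : Measure A} {γ : ℝ} {H : ℕ∞} {T : Teacher Ωp μ} {lo hi : EReal}

lemma _root_.TGRL.Teacher.measurable_logLoss_toReal (T : Teacher Ωp μ) (lo hi : EReal) :
    Measurable fun p : Ωp × A => (T.logLoss lo hi p.1 p.2).toReal := by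
  unfold Teacher.logLoss
  have h : Measurable fun p : Ωp × A => -(ENNReal.log (T.dens p.1 p.2)) :=
    (ENNReal.measurable_log.comp T.dens_meas).neg
  exact (measurable_const.max (h.min measurable_const)).ereal_toReal

/-- Real bounds exclude the infinite values, so the default of `toReal` at `⊤` and `⊥` never enters.
-/
lemma _root_.TGRL.Teacher.abs_logLoss_toReal_le {B : ℝ} {ω : Ωp} {a : A}
    (h : ((-B : ℝ) : EReal) ≤ T.logLoss lo hi ω a ∧ T.logLoss lo hi ω a ≤ (B : EReal)) :
    |(T.logLoss lo hi ω a).toReal| ≤ B := by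
  have h1 : T.logLoss lo hi ω a ≠ ⊤ := ne_top_of_le_ne_top (EReal.coe_ne_top B) h.2
  have h2 : T.logLoss lo hi ω a ≠ ⊥ := ne_bot_of_le_ne_bot (EReal.coe_ne_bot (-B)) h.1
  rw [← EReal.coe_toReal h1 h2, EReal.coe_le_coe_iff, EReal.coe_le_coe_iff] at h
  exact abs_le.2 h

lemma measurable_reward_step :
    Measurable fun y : Step S Ω Ωp A => M.reward y.state y.action :=
  M.reward_meas.comp (f := fun y : Step S Ω Ωp A => (y.1.1, y.2)) (by fun_prop)

lemma _root_.TGRL.Teacher.measurable_logLoss_step :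
    Measurable fun y : Step S Ω Ωp A => (T.logLoss lo hi y.priv y.action).toReal :=
  (T.measurable_logLoss_toReal lo hi).comp (f := fun y : Step S Ω Ωp A => (y.1.2.2, y.2))
    (by fun_prop)

/-- The teacher-guided objective in terms of the laws of the single steps. -/
lemma JTG_eq (hw : Summable (weight γ H)) {B : ℝ} (hB : ∀ s a, |M.reward s a| ≤ B) {D : ℝ}
    (hD : ∀ ω a, |(T.logLoss lo hi ω a).toReal| ≤ D) (α : ℝ) :
    M.JTG γ H T lo hi π α
      = M.stepSum (weight γ H) (fun y => M.reward y.state y.action) π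
        - α * M.stepSum (weight γ H) (fun y => (T.logLoss lo hi y.priv y.action).toReal) π := by
  have hr := M.measurable_reward_step
  have hℓ := Teacher.measurable_logLoss_step (S := S) (Ω := Ω) (T := T) (lo := lo) (hi := hi)
  rw [← M.stepSum_sub_mul π hw hr (fun _ => hB _ _) hℓ (fun _ => hD _ _)]
  have hce (t : ℕ) : Measurable fun x : ℕ → Step S Ω Ωp A =>
      T.crossEntropy lo hi π t (hist t x) (x t).priv := by
    have hm : Measurable fun z : Pre S Ω Ωp A t × A => (T.logLoss lo hi z.1.2.2.2 z.2).toReal :=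
      (T.measurable_logLoss_toReal lo hi).comp
        (f := fun z : Pre S Ω Ωp A t × A => (z.1.2.2.2, z.2)) (by fun_prop)
    exact (hm.stronglyMeasurable.integral_kernel_prod_right'
      (κ := (π.act t).comap (preHist t) (measurable_preHist t))).measurable.comp (measurable_pre t)
  have hceD (t : ℕ) (x : ℕ → Step S Ω Ωp A) :
      |T.crossEntropy lo hi π t (hist t x) (x t).priv| ≤ D := by
    simpa [Teacher.crossEntropy] using norm_integral_le_of_norm_le_const (μ := π.act t (hist t x))
      (f := fun a => (T.logLoss lo hi (x t).priv a).toReal) (.of_forall fun a => hD _ a)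
  have hrt (t : ℕ) : Measurable fun x : ℕ → Step S Ω Ωp A => M.reward (x t).state (x t).action :=
    hr.comp (measurable_pi_apply t)
  rw [JTG, stepSum, integral_tsum_mul hw (C := B + |α| * D)
    (f := fun t x => M.reward (x t).state (x t).action
      - α * T.crossEntropy lo hi π t (hist t x) (x t).priv)
    (fun t => (hrt t).sub ((hce t).const_mul α))]
  · refine tsum_congr fun t => ?_
    have hi1 := M.integrable_step π hr (fun _ => hB _ _) t
    have hi2 := M.integrable_step π hℓ (fun _ => hD _ _) t
    have hi3 : Integrable (fun x => T.crossEntropy lo hi π t (hist t x) (x t).priv) (M.law π) :=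
      .of_bound (hce t).aestronglyMeasurable D (.of_forall (hceD t))
    rw [integral_sub hi1 (hi3.const_mul α), integral_sub hi1 (hi2.const_mul α),
      integral_const_mul, integral_const_mul,
      M.integral_step_eq π (T.measurable_logLoss_toReal lo hi) hD t]
    rfl
  · intro t x
    refine (abs_sub _ _).trans (add_le_add (hB _ _) ?_)
    rw [abs_mul]
    exact mul_le_mul_of_nonneg_left (hceD t x) (abs_nonneg _)

lemma JR_eq (hw : Summable (weight γ H)) {B : ℝ} (hB : ∀ s a, |M.reward s a| ≤ B) :
    M.JR γ H π = M.stepSum (weight γ H) (fun y => M.reward y.state y.action) π :=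
  integral_tsum_mul hw
    (fun t => M.measurable_reward_step.comp (measurable_pi_apply t)) (fun _ _ => hB _ _)

/-! ### Duality for the POMDP. -/

/-- Strong duality under Slater's condition. -/
theorem noDualityGap_of_lt_optimalReturn (hw : Summable (weight γ H)) {B : ℝ}
    (hB : ∀ s a, |M.reward s a| ≤ B) {D : ℝ} (hD : ∀ ω a, |(T.logLoss lo hi ω a).toReal| ≤ D)
    (α : ℝ) {η : ℝ} (hη : (η : EReal) < M.optimalReturn γ H) :
    M.NoDualityGap γ H T lo hi α η := by
  have hr := M.measurable_reward_step
  have hℓ := Teacher.measurable_logLoss_step (S := S) (Ω := Ω) (T := T) (lo := lo) (hi := hi)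
  have hslater : ∃ π : Policy Ω A, η < M.JR γ H π := by
    obtain ⟨π, hπ⟩ := lt_iSup_iff.1 hη
    exact ⟨π, EReal.coe_lt_coe_iff.1 hπ⟩
  have hbound : ∀ y : Step S Ω Ωp A,
      |M.reward y.state y.action - α * (T.logLoss lo hi y.priv y.action).toReal|
        ≤ B + |α| * D := fun y => by
    refine (abs_sub _ _).trans (add_le_add (hB _ _) ?_)
    rw [abs_mul]
    exact mul_le_mul_of_nonneg_left (hD _ _) (abs_nonneg _)
  have h := isLeast_dual (J := M.JR γ H) (G := fun π => M.JTG γ H T lo hi π α)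
    (C := ∑' t, |weight γ H t| * (B + |α| * D)) (η := η) ?_ (fun π => ?_) hslater
  · have himage : M.dualFunction γ H T lo hi α η '' Set.Ici 0
        = (fun l : ℝ => ⨆ π, ((M.JTG γ H T lo hi π α + l * (M.JR γ H π - η) : ℝ) : EReal))
          '' Set.Ici 0 := ?_
    · rw [NoDualityGap, himage]
      exact h
    refine Set.image_congr fun l hl => iSup_congr fun π => ?_
    have hl' : 1 + l ≠ 0 := by
      have := Set.mem_Ici.1 hl
      positivity
    rw [M.JTG_eq π hw hB hD, M.JTG_eq π hw hB hD, M.JR_eq π hw hB]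
    congr 1
    field_simp
    ring
  · intro π₁ π₂ a b ha hb hab
    have hab' : ENNReal.ofReal a + ENNReal.ofReal b = 1 := by
      rw [← ENNReal.ofReal_add ha hb, hab, ENNReal.ofReal_one]
    refine ⟨M.mixPolicy π₁ π₂ hab', ?_, ?_⟩
    · simp only [M.JR_eq _ hw hB, M.stepSum_mixPolicy hw hr (fun _ => hB _ _),
        ENNReal.toReal_ofReal ha, ENNReal.toReal_ofReal hb]
    · simp only [M.JTG_eq _ hw hB hD, M.stepSum_mixPolicy hw hr (fun _ => hB _ _),
        M.stepSum_mixPolicy hw hℓ (fun _ => hD _ _),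
        ENNReal.toReal_ofReal ha, ENNReal.toReal_ofReal hb]
      ring
  · rw [M.JTG_eq π hw hB hD, ← M.stepSum_sub_mul π hw hr (fun _ => hB _ _) hℓ (fun _ => hD _ _)]
    exact M.stepSum_le π hw hbound

end POMDP

end

end TGRL

theorem proposition2 {S Ω Ωp A : Type*} [MeasurableSpace S] [MeasurableSpace Ω]
    [MeasurableSpace Ωp] [MeasurableSpace A] {μ : Measure A}
    (M : TGRL.POMDP S Ω Ωp A) (T : TGRL.Teacher Ωp μ) (lo hi : EReal)
    (γ : ℝ) (H : ℕ∞) (hγ0 : 0 ≤ γ) (hγ1 : γ ≤ 1) (hH : H = ⊤ → γ < 1) (α : ℝ)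
    -- the reward and the (clipped) cross-entropy term are bounded
    (hr : ∃ B : ℝ, ∀ s a, |M.reward s a| ≤ B)
    (hX : ∃ B : ℝ, ∀ ω a,
      ((-B : ℝ) : EReal) ≤ T.logLoss lo hi ω a ∧ T.logLoss lo hi ω a ≤ (B : EReal))
    (η : ℕ → ℝ)
    -- every `η i` stays below the optimal return by a fixed `ε > 0`
    (hη : ∃ ε : ℝ, 0 < ε ∧ ∀ i, ((η i + ε : ℝ) : EReal) ≤ M.optimalReturn γ H) :
    (∀ i, M.NoDualityGap γ H T lo hi α (η i)) ∧
      (∀ ηlim : ℝ, Tendsto η atTop (𝓝 ηlim) → M.NoDualityGap γ H T lo hi α ηlim) := by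
  obtain ⟨B, hB⟩ := hr
  obtain ⟨D, hD⟩ := hX
  obtain ⟨ε, hε, hle⟩ := hη
  -- The margin is kept as a non-strict inequality: it implies Slater's condition and, unlike the
  -- strict one, is closed under limits in `c`.
  have key (c : ℝ) (hc : ((c + ε : ℝ) : EReal) ≤ M.optimalReturn γ H) :
      M.NoDualityGap γ H T lo hi α c :=
    M.noDualityGap_of_lt_optimalReturn (TGRL.summable_weight hγ0 hH) hB
      (fun ω a => TGRL.Teacher.abs_logLoss_toReal_le (hD ω a)) α
      ((EReal.coe_lt_coe_iff.2 (lt_add_of_pos_right c hε)).trans_le hc)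
  refine ⟨fun i => key _ (hle i), fun c hc => key c ?_⟩
  exact le_of_tendsto ((continuous_coe_real_ereal.tendsto _).comp (hc.add_const ε))
    (.of_forall hle)
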